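/- **Conventions.** Let $\mathfrak A$ be a C*-algebra without unit, $u\mathfrak A=\mathfrak A\oplus\mathbb C1$ its unitization, $\mathscr S(\mathfrak A)$ its state space (positive functionals of norm one); a state $\varphi$ is extended to $u\mathfrak A$ by $\varphi(1)=1$ and to a normal state of the enveloping von Neumann algebra $\mathfrak A^{**}$. A *Lipschitz triple* $(\mathfrak A,\mathsf L,\mathfrak M)$ consists of $\mathfrak A$, a seminorm $\mathsf L$ defined on a dense subspace of $\mathfrak{sa}(u\mathfrak A)$ (with $\mathsf L=\infty$ off this subspace) such that $\mathsf L(a)=0$ if and only if $a\in\mathbb R1$, and an Abelian C*-subalgebra $\mathfrak M\subseteq\mathfrak A$ (the topography) containing an approximate identity for $\mathfrak A$. Its extended Monge–Kantorovich metric on $\mathscr S(\mathfrak A)$ is $$\mathsf{mk}_{\mathsf L}(\varphi,\psi)=\sup\{|\varphi(a)-\psi(a)|: a\in\mathfrak{sa}(\mathfrak A),\ \mathsf L(a)\le 1\}\in[0,\infty].$$ For a compact subset $K$ of the Gel'fand spectrum $\sigma(\mathfrak M)$ let $1_K\in\mathfrak M^{**}\subseteq\mathfrak A^{**}$ be its indicator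 function and $\mathscr S(\mathfrak A|K)=\{\varphi\in\mathscr S(\mathfrak A):\varphi(1_K)=1\}$; the *local states* are the elements of $\bigcup_K\mathscr S(\mathfrak A|K)$. A set $\mathscr K\subseteq\mathscr S(\mathfrak A)$ is *tame* if for some local state $\mu$ $$\lim_{K}\ \sup\{|\varphi(a-1_Ka1_K)| : \varphi\in\mathscr K,\ a\in\mathfrak{sa}(u\mathfrak A),\ \mathsf L(a)\le1,\ \mu(a)=0\}=0,$$ the limit being along the compact subsets $K$ of $\sigma(\mathfrak M)$ directed by inclusion. The triple $(\mathfrak A,\mathsf L,\mathfrak M)$ is a *quantum locally compact metric space* if $\mathscr S(\mathfrak A|K)$ has finite $\mathsf{mk}_{\mathsf L}$-diameter for every compact $K\subseteq\sigma(\mathfrak M)$, and if on every tame set $\mathscr K$ the topology of $\mathsf{mk}_{\mathsf L}$ is the relative weak* topology. **Proposition.** Let $\mathfrak K$ be the C*-algebra of compact operators on a Hilbert space $\mathcal H$ with a Hilbert basis $(\zeta_n)_{n\in\mathbb N}$, and let $P_n$ be the orthogonal projection of $\mathcal H$ onto $\mathrm{span}\{\zeta_0,\dots,\zeta_n\}$.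 Let $\alpha>0$ and let $(\omega_n)_{n\in\mathbb N}$ be a sequence of real numbers with $\omega_n\ge\alpha$ for all $n$. For $T\in\mathfrak K$ set $$\mathsf L(T)=\sup\{\omega_n^{-1}\|P_nTP_n\| : n\in\mathbb N\},$$ and extend $\mathsf L$ to $\mathfrak{sa}(u\mathfrak K)$ by $\mathsf L(a+\lambda1)=\mathsf L(a)$ for $a\in\mathfrak{sa}(\mathfrak K)$ and $\lambda\in\mathbb R$. Let $\mathfrak D\subseteq\mathfrak K$ be the C*-subalgebra of the compact operators that are diagonal in $(\zeta_n)_{n\in\mathbb N}$. Then $\mathfrak D$ is the C*-algebra generated by $(P_n)_{n\in\mathbb N}$, and $(\mathfrak K,\mathsf L,\mathfrak D)$ is a quantum locally compact metric space. -/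

import Mathlib

open Filter Topology TopologicalSpace
open scoped ENNReal

noncomputable section

namespace QuantumMetric

/-! ### States and the bidual of a C*-algebra -/

section General

variable {A : Type*} [NonUnitalCStarAlgebra A]

/-- The state space `𝒮(A)`: the positive linear functionals of norm one. -/
def stateSpace (A : Type*) [NonUnitalCStarAlgebra A] : Set (StrongDual ℂ A) :=
  {φ | (∀ a : A, 0 ≤ (φ (star a * a)).re ∧ (φ (star a * a)).im = 0) ∧ ‖φ‖ = 1}

/-- The extension of a functional `φ` of `A` to the unitization `A ⊕ ℂ 1` with `φ 1 = 1`. -/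
def unitalExtension (φ : StrongDual ℂ A) (u : Unitization ℂ A) : ℂ :=
  u.fst + φ u.snd

/-- The bidual `A**`; it is the enveloping von Neumann algebra of `A` when equipped with the
product `arensMul` below. -/
abbrev Bidual (A : Type*) [NonUnitalCStarAlgebra A] : Type _ :=
  StrongDual ℂ (StrongDual ℂ A)

/-- The action of `A` on its dual: `dualAction φ a` is the functional `b ↦ φ (a * b)`. -/
def dualAction : StrongDual ℂ A →L[ℂ] A →L[ℂ] StrongDual ℂ A :=
  ((ContinuousLinearMap.compL ℂ A (A →L[ℂ] A) (StrongDual ℂ A)).flip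
    (ContinuousLinearMap.mul ℂ A)).comp (ContinuousLinearMap.compL ℂ A A ℂ)

theorem dualAction_apply (φ : StrongDual ℂ A) (a b : A) : dualAction φ a b = φ (a * b) := rfl

/-- The (Arens) product of the bidual `A**`, that is, the product of the enveloping von Neumann
algebra: `(F G)(φ) = F (a ↦ G (b ↦ φ (a * b)))`. -/
def arensMul (F G : Bidual A) : Bidual A :=
  F.comp ((ContinuousLinearMap.compL ℂ A (StrongDual ℂ A) ℂ G).comp dualAction)

theorem arensMul_apply (F G : Bidual A) (φ : StrongDual ℂ A) :
    arensMul F G φ = F (G.comp (dualAction φ)) := rfl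

/-- The product of `A**` extends that of `A`. -/
theorem arensMul_inclusion (a b : A) :
    arensMul (NormedSpace.inclusionInDoubleDual ℂ A a) (NormedSpace.inclusionInDoubleDual ℂ A b) =
      NormedSpace.inclusionInDoubleDual ℂ A (a * b) := rfl

/-! ### Lipschitz pairs -/

/-- A Lipschitz pair `(A, L)`, for a C*-algebra `A` without unit, whose smallest unital
C*-algebra is thus the unitization `A ⊕ ℂ 1`: a seminorm `L` on a dense subspace of the
self-adjoint part of the unitization, vanishing exactly on `ℝ 1`.
The seminorm takes the value `∞` exactly off its domain. -/
structure IsLipschitzPair (L : selfAdjoint (Unitization ℂ A) → ℝ≥0∞) : Prop where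
  nonunital : ¬ ∃ e : A, ∀ a : A, e * a = a ∧ a * e = a
  smul : ∀ (r : ℝ) (u : selfAdjoint (Unitization ℂ A)), L (r • u) = ENNReal.ofReal |r| * L u
  add_le : ∀ u v : selfAdjoint (Unitization ℂ A), L (u + v) ≤ L u + L v
  dense_domain : Dense {u : selfAdjoint (Unitization ℂ A) | L u < ∞}
  eq_zero_iff : ∀ u : selfAdjoint (Unitization ℂ A),
    L u = 0 ↔ ∃ r : ℝ, (u : Unitization ℂ A) = (r : ℂ) • (1 : Unitization ℂ A)

/-- The extension to the self-adjoint part of the unitization, by `L (a + λ 1) = L a`, of a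
function `L` on a C*-algebra without unit. -/
def extendToUnitization (L : A → ℝ≥0∞) (u : selfAdjoint (Unitization ℂ A)) : ℝ≥0∞ :=
  L (u : Unitization ℂ A).snd

/-- A self-adjoint element of `A`, seen in the unitization. -/
def selfAdjointInr (a : selfAdjoint A) : selfAdjoint (Unitization ℂ A) :=
  ⟨((a : A) : Unitization ℂ A), by
    rw [selfAdjoint.mem_iff, ← Unitization.inr_star, selfAdjoint.mem_iff.1 a.2]⟩

/-- The extended Monge-Kantorovich metric
`mk_L (φ, ψ) = sup {|φ a - ψ a| : a ∈ sa(A), L a ≤ 1}`. -/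
def mongeKantorovich (L : selfAdjoint (Unitization ℂ A) → ℝ≥0∞) (φ ψ : StrongDual ℂ A) : ℝ≥0∞ :=
  ⨆ (a : selfAdjoint A) (_ : L (selfAdjointInr a) ≤ 1), ‖φ (a : A) - ψ (a : A)‖ₑ

/-- The structure given by the extended Monge-Kantorovich metric (a pseudo-metric in the absence
of further assumptions on `L`; the separation axiom follows from the density of the domain). -/
abbrev mongeKantorovichSpace (L : selfAdjoint (Unitization ℂ A) → ℝ≥0∞) :
    PseudoEMetricSpace (StrongDual ℂ A) where
  edist := mongeKantorovich L
  edist_self φ := by simp [mongeKantorovich]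
  edist_comm φ ψ := by
    simp only [mongeKantorovich]
    refine iSup_congr fun a => iSup_congr fun _ => ?_
    rw [← enorm_neg, neg_sub]
  edist_triangle φ ψ χ := by
    refine iSup₂_le fun a ha => ?_
    have h : φ (a : A) - χ (a : A) = (φ (a : A) - ψ (a : A)) + (ψ (a : A) - χ (a : A)) := by
      ring
    rw [h]
    refine (enorm_add_le _ _).trans (add_le_add ?_ ?_)
    · exact le_iSup₂ (f := fun (a : selfAdjoint A) (_ : L (selfAdjointInr a) ≤ 1) =>
        ‖φ (a : A) - ψ (a : A)‖ₑ) a ha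
    · exact le_iSup₂ (f := fun (a : selfAdjoint A) (_ : L (selfAdjointInr a) ≤ 1) =>
        ‖ψ (a : A) - χ (a : A)‖ₑ) a ha

/-- The set `{u ∈ sa(A ⊕ ℂ 1) : L u ≤ 1 and μ u = 0}`. -/
def lipschitzBall (L : selfAdjoint (Unitization ℂ A) → ℝ≥0∞) (μ : StrongDual ℂ A) :
    Set (selfAdjoint (Unitization ℂ A)) :=
  {u | L u ≤ 1 ∧ unitalExtension μ (u : Unitization ℂ A) = 0}

/-! ### Topographic quantum spaces -/

/-- `(A, M)` is a topographic quantum space: `M` is an abelian C*-subalgebra of `A` which contains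
an approximate identity for `A`. -/
structure IsTopography (M : NonUnitalStarSubalgebra ℂ A) : Prop where
  isClosed : IsClosed (M : Set A)
  comm : ∀ a ∈ M, ∀ b ∈ M, a * b = b * a
  exists_approximateUnit : ∃ l : Filter A, l.IsApproximateUnit ∧ ∀ᶠ e in l, e ∈ M

/-- The Gel'fand spectrum `σ(M)` of `M`, with its weak* topology. -/
abbrev spectrumOf (M : NonUnitalStarSubalgebra ℂ A) : Type _ := WeakDual.characterSpace ℂ M

/-- The elements `f` of `M` which, as functions on `σ(M)`, satisfy `0 ≤ f ≤ 1`, with `f = 1`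
on `K`. -/
def plateauFunctions (M : NonUnitalStarSubalgebra ℂ A) (K : Set (spectrumOf M)) : Set M :=
  {f | (∀ χ : spectrumOf M, 0 ≤ (χ f).re ∧ (χ f).re ≤ 1 ∧ (χ f).im = 0) ∧
    ∀ χ ∈ K, χ f = 1}

/-- The filter of tails of the family of the elements of `plateauFunctions M K`, directed
downwards by the pointwise order on `σ(M)`. For compact `K` this family decreases pointwise to the
indicator function of `K`. -/
def plateauFilter (M : NonUnitalStarSubalgebra ℂ A) (K : Set (spectrumOf M)) : Filter M :=
  ⨅ f ∈ plateauFunctions M K,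
    𝓟 {g | g ∈ plateauFunctions M K ∧ ∀ χ : spectrumOf M, (χ g).re ≤ (χ f).re}

/-- The indicator function of a compact subset `K` of `σ(M)`, as a projection of `M** ⊆ A**`: it
is the infimum, hence the weak* limit in `A**`, of the decreasing net of all `f ∈ M` with
`0 ≤ f ≤ 1` on `σ(M)` and `f = 1` on `K`. Thus for a state `φ`, its value at `φ` is `ν K`,
where `ν` is the Radon probability measure on `σ(M)` representing the restriction of `φ` to `M`. -/
def indicator (M : NonUnitalStarSubalgebra ℂ A) (K : Set (spectrumOf M)) : Bidual A :=
  WeakDual.toStrongDual (limUnder (plateauFilter M K) fun f =>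
    StrongDual.toWeakDual (NormedSpace.inclusionInDoubleDual ℂ A (f : A)))

/-- The element `1_K u 1_K` of `A**`, for `u = λ 1 + a` in the unitization of `A`. -/
def cutDown (M : NonUnitalStarSubalgebra ℂ A) (K : Set (spectrumOf M)) (u : Unitization ℂ A) :
    Bidual A :=
  u.fst • arensMul (indicator M K) (indicator M K) +
    arensMul (arensMul (indicator M K) (NormedSpace.inclusionInDoubleDual ℂ A u.snd))
      (indicator M K)

/-- The set `𝒮(A|K)` of the states `φ` of `A` with `φ (1_K) = 1`. -/
def statesOn (M : NonUnitalStarSubalgebra ℂ A) (K : Set (spectrumOf M)) : Set (StrongDual ℂ A) :=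
  {φ | φ ∈ stateSpace A ∧ indicator M K φ = 1}

/-- The local state space `𝒮(A|M)`. -/
def localStates (M : NonUnitalStarSubalgebra ℂ A) : Set (StrongDual ℂ A) :=
  ⋃ K : Compacts (spectrumOf M), statesOn M (K : Set (spectrumOf M))

/-! ### Quantum locally compact metric spaces -/

/-- `(A, L, M)` is a Lipschitz triple. -/
structure IsLipschitzTriple (L : selfAdjoint (Unitization ℂ A) → ℝ≥0∞)
    (M : NonUnitalStarSubalgebra ℂ A) : Prop where
  isLipschitzPair : IsLipschitzPair L
  isTopography : IsTopography M

/-- A set `S` of states is `(A, L, M)`-tame when, for some local state `μ`,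
`lim_K sup {|φ (u - 1_K u 1_K)| : u ∈ lipschitzBall L μ, φ ∈ S} = 0`, the limit being along
the compact subsets `K` of `σ(M)`, directed by inclusion. -/
def IsTame (L : selfAdjoint (Unitization ℂ A) → ℝ≥0∞) (M : NonUnitalStarSubalgebra ℂ A)
    (S : Set (StrongDual ℂ A)) : Prop :=
  S ⊆ stateSpace A ∧ ∃ μ ∈ localStates M,
    Tendsto (fun K : Compacts (spectrumOf M) =>
        ⨆ (φ ∈ S) (u ∈ lipschitzBall L μ),
          ‖unitalExtension φ (u : Unitization ℂ A) -
            cutDown M (K : Set (spectrumOf M)) (u : Unitization ℂ A) φ‖ₑ)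
      atTop (𝓝 0)

/-- Regularity: for every compact `K ⊆ σ(M)`, the set `𝒮(A|K)` has finite diameter for the
extended Monge-Kantorovich metric. -/
def IsRegular (L : selfAdjoint (Unitization ℂ A) → ℝ≥0∞) (M : NonUnitalStarSubalgebra ℂ A) :
    Prop :=
  ∀ K : Compacts (spectrumOf M),
    (⨆ (φ ∈ statesOn M (K : Set (spectrumOf M))) (ψ ∈ statesOn M (K : Set (spectrumOf M))),
      mongeKantorovich L φ ψ) < ∞

/-- On the set `S` of functionals, the topology of the extended Monge-Kantorovich metric
(left-hand side) is the relative topology induced by the weak* topology (right-hand side). -/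
def MetrizesWeakStarOn (L : selfAdjoint (Unitization ℂ A) → ℝ≥0∞) (S : Set (StrongDual ℂ A)) :
    Prop :=
  (PseudoEMetricSpace.induced (Subtype.val : S → StrongDual ℂ A)
      (mongeKantorovichSpace L)).toUniformSpace.toTopologicalSpace =
    TopologicalSpace.induced (fun φ : S => StrongDual.toWeakDual (φ : StrongDual ℂ A))
      (inferInstance : TopologicalSpace (WeakDual ℂ A))

/-- `(A, L, M)` is a quantum locally compact metric space, for a C*-algebra `A` without unit: a
regular Lipschitz triple such that on every tame set of states, the extended Monge-Kantorovich
metric induces the relative weak* topology. -/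
structure IsQuantumLocallyCompactMetricSpace (L : selfAdjoint (Unitization ℂ A) → ℝ≥0∞)
    (M : NonUnitalStarSubalgebra ℂ A) : Prop extends IsLipschitzTriple L M where
  regular : IsRegular L M
  metrizes : ∀ S : Set (StrongDual ℂ A), IsTame L M S → MetrizesWeakStarOn L S

end General

/-! ### The compact operators -/

section CompactOperators

variable {H : Type*} [NormedAddCommGroup H] [InnerProductSpace ℂ H] [CompleteSpace H]

theorem isCompactOperator_adjoint {T : H →L[ℂ] H} (hT : IsCompactOperator T) :
    IsCompactOperator (ContinuousLinearMap.adjoint T) := by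
  set T' := ContinuousLinearMap.adjoint T with hT'
  have hTT : IsCompactOperator (T ∘ T') := hT.comp_clm T'
  have h1 : TotallyBounded ((T ∘ T') '' Metric.ball (0 : H) 1) := by
    have := (IsCompactOperator.isCompact_closure_image_ball
      (f := ((T ∘L T' : H →L[ℂ] H) : H →ₗ[ℂ] H)) hTT 1)
    exact this.totallyBounded.subset subset_closure
  refine (isCompactOperator_iff_isCompact_closure_image_ball (T' : H →ₗ[ℂ] H) one_pos).2 ?_
  refine TotallyBounded.isCompact_of_isClosed ?_ isClosed_closure
  refine TotallyBounded.closure ?_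
  rw [Metric.totallyBounded_iff]
  intro ε hε
  obtain ⟨t, hts, htf, ht⟩ := totallyBounded_iff_subset.1 h1 _
    (Metric.dist_mem_uniformity (show 0 < ε ^ 2 / 2 by positivity))
  have hts' : ∀ y ∈ t, ∃ x ∈ Metric.ball (0 : H) 1, T (T' x) = y := fun y hy => hts hy
  choose! z hz hzt using hts'
  refine ⟨(fun y => T' (z y)) '' t, htf.image _, ?_⟩
  rintro _ ⟨x, hx, rfl⟩
  obtain ⟨y, hy, hxy⟩ := Set.mem_iUnion₂.1 (ht ⟨x, hx, rfl⟩)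
  refine Set.mem_iUnion₂.2 ⟨T' (z y), ⟨y, hy, rfl⟩, ?_⟩
  have hxy' : ‖T (T' (x - z y))‖ < ε ^ 2 / 2 := by
    have h : dist (T (T' x)) y < ε ^ 2 / 2 := hxy
    rw [← hzt y hy, dist_eq_norm] at h
    simpa [map_sub] using h
  have hxz : ‖x - z y‖ ≤ 2 := by
    have a1 : ‖x‖ < 1 := by simpa using hx
    have a2 : ‖z y‖ < 1 := by simpa using hz y hy
    have := norm_sub_le x (z y)
    linarith
  have key : ‖T' (x - z y)‖ ^ 2 < ε ^ 2 := by
    have e : ‖T' (x - z y)‖ ^ 2 = RCLike.re (inner ℂ (x - z y) (T (T' (x - z y)))) := by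
      rw [← ContinuousLinearMap.adjoint_inner_left, ← hT', inner_self_eq_norm_sq]
    rw [e]
    calc RCLike.re (inner ℂ (x - z y) (T (T' (x - z y))))
        ≤ ‖x - z y‖ * ‖T (T' (x - z y))‖ := re_inner_le_norm _ _
      _ ≤ 2 * ‖T (T' (x - z y))‖ := by gcongr
      _ < ε ^ 2 := by linarith
  have := lt_of_pow_lt_pow_left₀ 2 hε.le key
  simpa [dist_eq_norm, map_sub] using this

/-- The C*-algebra of the compact operators on the Hilbert space `H`. -/
def compactOperators (H : Type*) [NormedAddCommGroup H] [InnerProductSpace ℂ H]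
    [CompleteSpace H] : NonUnitalStarSubalgebra ℂ (H →L[ℂ] H) where
  carrier := {T | IsCompactOperator T}
  zero_mem' := isCompactOperator_zero
  add_mem' hS hT := hS.add hT
  smul_mem' c _ hT := hT.smul c
  mul_mem' {_ T} hS _ := hS.comp_clm T
  star_mem' hT := isCompactOperator_adjoint hT

instance : IsClosed (compactOperators H : Set (H →L[ℂ] H)) :=
  isClosed_setOfPred_isCompactOperator

/-- The orthogonal projection onto the span of `ζ 0, …, ζ n`. -/
def basisProjection (ζ : HilbertBasis ℕ ℂ H) (n : ℕ) : H →L[ℂ] H :=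
  haveI : FiniteDimensional ℂ (Submodule.span ℂ ((fun i => ζ i) '' Set.Iic n)) :=
    FiniteDimensional.span_of_finite ℂ ((Set.finite_Iic n).image _)
  (Submodule.span ℂ ((fun i => ζ i) '' Set.Iic n)).starProjection

/-- `L T = sup_n ω_n⁻¹ ‖P_n T P_n‖` for a compact operator `T`. -/
def weightedSeminorm (ζ : HilbertBasis ℕ ℂ H) (ω : ℕ → ℝ) (T : compactOperators H) : ℝ≥0∞ :=
  ⨆ n : ℕ, ENNReal.ofReal
    ((ω n)⁻¹ * ‖basisProjection ζ n * (T : H →L[ℂ] H) * basisProjection ζ n‖)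

/-- The C*-algebra of the compact operators which are diagonal in the Hilbert basis `ζ`. -/
def diagonalCompacts (ζ : HilbertBasis ℕ ℂ H) :
    NonUnitalStarSubalgebra ℂ (compactOperators H) where
  carrier := {T | ∀ n, ∃ c : ℂ, (T : H →L[ℂ] H) (ζ n) = c • ζ n}
  zero_mem' n := ⟨0, by simp⟩
  add_mem' {S T} hS hT n := by
    obtain ⟨c, hc⟩ := hS n
    obtain ⟨d, hd⟩ := hT n
    exact ⟨c + d, by simp [hc, hd, add_smul]⟩
  smul_mem' r T hT n := by
    obtain ⟨c, hc⟩ := hT n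
    exact ⟨r * c, by simp [hc, mul_smul]⟩
  mul_mem' {S T} hS hT n := by
    obtain ⟨c, hc⟩ := hS n
    obtain ⟨d, hd⟩ := hT n
    exact ⟨d * c, by simp [hc, hd, mul_smul]⟩
  star_mem' {T} hT n := by
    obtain ⟨c, hc⟩ := hT n
    refine ⟨star c, ζ.repr.injective ?_⟩
    ext i
    obtain ⟨d, hd⟩ := hT i
    rw [ζ.repr_apply_apply, ζ.repr_apply_apply]
    have e : ((star T : compactOperators H) : H →L[ℂ] H) =
        ContinuousLinearMap.adjoint (T : H →L[ℂ] H) := rfl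
    rw [e, ContinuousLinearMap.adjoint_inner_right, hd, inner_smul_left, inner_smul_right]
    by_cases h : i = n
    · subst h
      have hz : (ζ i : H) ≠ 0 := by
        have := ζ.orthonormal.1 i
        intro h0
        simp [h0] at this
      have : d = c := smul_left_injective ℂ hz (hd.symm.trans hc)
      simp [this]
    · simp [ζ.orthonormal.2 h]

end CompactOperators

end QuantumMetric

end

noncomputable section

namespace QuantumMetric

open InnerProductSpace

/-! ### Functionals attaining their norm at a projection -/

section NormAttaining

variable {A : Type*} [NonUnitalCStarAlgebra A]

/-! The diagonal algebra is spanned, up to closure, by the minimal projections `matrixUnit ζ n n`,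
so its spectrum is a discrete copy of ℕ. A compact `K` is therefore a finite set `F`, and `1_K` is
the finite-rank projection `P_F`, an element of the algebra itself
(`IsDiagonalSystem.exists_indicator_eq`). All conditions stated in the bidual thus become conditions
on the corners `P_F T P_F`.

A state equal to `1` at `P_F` factors through this corner (`map_eq_map_mul_mul`), and `L T ≤ 1`
bounds the matrix entry `(i, j)` of `T` by `ω (max i j)`. Regularity follows.

For a tame set, apply the definition to `T - μ(T) 1`. A single `F` makes the truncation error at
most `δ` for all states of the set and all `T` in the Lipschitz ball. What remains of `φ(T) - ψ(T)`
is controlled by the values of `φ - ψ` at `P_F` and at finitely many matrix units, with coefficients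
independent of `T` (`mongeKantorovich_le_of_compression`). Hence weak* neighbourhoods lie inside
metric balls. Conversely `L T ≤ α⁻¹ ‖T‖`, so evaluation at a self-adjoint element is Lipschitz for
the metric.

The generation statement holds because `matrixUnit ζ n n` is a difference of consecutive projections
and `P_n T → T` in norm for compact `T`. -/

/-- A complex number `z` such that `‖1 + c z‖ ^ 2` is bounded by `1 + O (‖c‖ ^ 2)` is zero. -/
theorem eq_zero_of_norm_one_add_mul_sq_le {z : ℂ} {C : ℝ}
    (h : ∀ c : ℂ, ‖1 + c * z‖ ^ 2 ≤ 1 + ‖c‖ ^ 2 * C) : z = 0 := by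
  by_contra hz
  have hz' : 0 < ‖z‖ ^ 2 := by positivity
  have key : ∀ t : ℝ, 0 < t → 2 ≤ t * C := by
    intro t ht
    -- This choice makes the linear term real and positive: `(1 + t‖z‖²)² ≤ 1 + t²‖z‖²C` forces `2 ≤
    -- tC`, which fails for small `t`.
    have h1 := h (t * star z)
    have e : (1 : ℂ) + t * star z * z = ((1 + t * ‖z‖ ^ 2 : ℝ) : ℂ) := by
      have : star z * z = ((‖z‖ ^ 2 : ℝ) : ℂ) := by
        push_cast
        exact Complex.conj_mul' z
      rw [mul_assoc, this]
      push_cast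
      ring
    rw [e, Complex.norm_real, Real.norm_eq_abs, sq_abs, norm_mul, Complex.norm_real,
      Real.norm_eq_abs, norm_star, mul_pow, sq_abs] at h1
    have h2 : t * ‖z‖ ^ 2 * 2 ≤ t * ‖z‖ ^ 2 * (t * C) := by
      nlinarith [sq_nonneg (t * ‖z‖ ^ 2)]
    exact le_of_mul_le_mul_left h2 (by positivity)
  have hC : 0 < C := by linarith [key 1 one_pos]
  have h3 := key (1 / C) (by positivity)
  rw [one_div_mul_cancel hC.ne'] at h3
  norm_num at h3

theorem norm_sq_le_one_of_isStarProjection {p : A} (hp : IsStarProjection p) : ‖p‖ ^ 2 ≤ 1 := by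
  have h : ‖p‖ * ‖p‖ = ‖p‖ := by
    rw [← CStarRing.norm_star_mul_self, hp.isSelfAdjoint.star_eq, hp.isIdempotentElem.eq]
  nlinarith [norm_nonneg p, sq_nonneg (‖p‖ - 1)]

/-- A functional of norm at most one that is `1` at a projection `p` vanishes at all `w` with
`p w = 0`. -/
theorem map_eq_zero_of_mul_eq_zero {φ : StrongDual ℂ A} (hφ : ‖φ‖ ≤ 1) {p w : A}
    (hp : IsStarProjection p) (hφp : φ p = 1) (hw : p * w = 0) : φ w = 0 := by
  refine eq_zero_of_norm_one_add_mul_sq_le (C := ‖w‖ ^ 2) fun c => ?_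
  have hw' : star w * p = 0 := by
    simpa [hp.isSelfAdjoint.star_eq] using congrArg star hw
  -- The cross terms vanish, so the C*-identity gives a norm with no term linear in `c`.
  have e : star (p + c • w) * (p + c • w) = p + (star c * c) • (star w * w) := by
    rw [star_add, star_smul, hp.isSelfAdjoint.star_eq, add_mul, mul_add, mul_add,
      hp.isIdempotentElem.eq, mul_smul_comm, hw, smul_mul_assoc, hw', smul_mul_smul_comm]
    simp
  have hn : ‖p‖ ≤ 1 := by nlinarith [norm_sq_le_one_of_isStarProjection hp]
  calc ‖1 + c * φ w‖ ^ 2 = ‖φ (p + c • w)‖ ^ 2 := by simp [hφp]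
    _ ≤ ‖p + c • w‖ ^ 2 := by
      gcongr
      exact (φ.le_opNorm _).trans (mul_le_of_le_one_left (norm_nonneg _) hφ)
    _ = ‖p + (star c * c) • (star w * w)‖ := by rw [sq, ← CStarRing.norm_star_mul_self, e]
    _ ≤ ‖p‖ + ‖(star c * c) • (star w * w)‖ := norm_add_le _ _
    _ ≤ 1 + ‖c‖ ^ 2 * ‖w‖ ^ 2 := by
      rw [norm_smul, norm_mul, norm_star, CStarRing.norm_star_mul_self, sq, sq]
      gcongr

/-- A functional of norm at most one that is `1` at a projection `p` vanishes at all `w` with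
`w p = 0`. -/
theorem map_eq_zero_of_mul_eq_zero' {φ : StrongDual ℂ A} (hφ : ‖φ‖ ≤ 1) {p w : A}
    (hp : IsStarProjection p) (hφp : φ p = 1) (hw : w * p = 0) : φ w = 0 := by
  refine eq_zero_of_norm_one_add_mul_sq_le (C := ‖w‖ ^ 2) fun c => ?_
  have hw' : p * star w = 0 := by
    simpa [hp.isSelfAdjoint.star_eq] using congrArg star hw
  -- Here `w p = 0`, so the star goes on the right-hand factor for the cross terms to vanish.
  have e : (p + c • w) * star (p + c • w) = p + (c * star c) • (w * star w) := by
    rw [star_add, star_smul, hp.isSelfAdjoint.star_eq, add_mul, mul_add, mul_add,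
      hp.isIdempotentElem.eq, mul_smul_comm, hw', smul_mul_assoc, hw, smul_mul_smul_comm]
    simp
  have hn : ‖p‖ ≤ 1 := by nlinarith [norm_sq_le_one_of_isStarProjection hp]
  calc ‖1 + c * φ w‖ ^ 2 = ‖φ (p + c • w)‖ ^ 2 := by simp [hφp]
    _ ≤ ‖p + c • w‖ ^ 2 := by
      gcongr
      exact (φ.le_opNorm _).trans (mul_le_of_le_one_left (norm_nonneg _) hφ)
    _ = ‖p + (c * star c) • (w * star w)‖ := by rw [sq, ← CStarRing.norm_self_mul_star, e]
    _ ≤ ‖p‖ + ‖(c * star c) • (w * star w)‖ := norm_add_le _ _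
    _ ≤ 1 + ‖c‖ ^ 2 * ‖w‖ ^ 2 := by
      rw [norm_smul, norm_mul, norm_star, CStarRing.norm_self_mul_star, sq, sq]
      gcongr

/-- A functional of norm at most one that is `1` at a projection `p` is supported by `p`. -/
theorem map_eq_map_mul_mul {φ : StrongDual ℂ A} (hφ : ‖φ‖ ≤ 1) {p : A}
    (hp : IsStarProjection p) (hφp : φ p = 1) (a : A) : φ a = φ (p * a * p) := by
  have h1 : φ (a - p * a) = 0 := map_eq_zero_of_mul_eq_zero hφ hp hφp (by
    rw [mul_sub, ← mul_assoc, hp.isIdempotentElem.eq, sub_self])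
  have h2 : φ (p * a - p * a * p) = 0 := map_eq_zero_of_mul_eq_zero' hφ hp hφp (by
    rw [sub_mul, mul_assoc (p * a), hp.isIdempotentElem.eq, sub_self])
  rw [map_sub, sub_eq_zero] at h1 h2
  rw [h1, h2]

end NormAttaining

/-! ### Matrix units -/

theorem inner_basis {H : Type*} [NormedAddCommGroup H] [InnerProductSpace ℂ H]
    (ζ : HilbertBasis ℕ ℂ H) (i j : ℕ) : inner ℂ (ζ i) (ζ j) = if i = j then (1 : ℂ) else 0 :=
  orthonormal_iff_ite.1 ζ.orthonormal i j

theorem isCompactOperator_rankOne {H : Type*} [NormedAddCommGroup H] [InnerProductSpace ℂ H]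
    (x y : H) : IsCompactOperator (rankOne ℂ x y : H →L[ℂ] H) := by
  rw [rankOne_def']
  exact (isCompactOperator_of_locallyCompactSpace_rng
    (ContinuousLinearMap.toSpanSingleton ℂ x)).comp_clm (innerSL ℂ y)

section MatrixUnits

variable {H : Type*} [NormedAddCommGroup H] [InnerProductSpace ℂ H] [CompleteSpace H]

/-- The operator `x ↦ ⟪ζ j, x⟫ ζ i`. -/
def matrixUnit (ζ : HilbertBasis ℕ ℂ H) (i j : ℕ) : compactOperators H :=
  ⟨rankOne ℂ (ζ i) (ζ j), isCompactOperator_rankOne _ _⟩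

/-- The orthogonal projection onto the span of `ζ i`, `i ∈ F`, as a compact operator. -/
def finiteProjection (ζ : HilbertBasis ℕ ℂ H) (F : Finset ℕ) : compactOperators H :=
  ∑ i ∈ F, matrixUnit ζ i i

variable (ζ : HilbertBasis ℕ ℂ H)

theorem coe_matrixUnit (i j : ℕ) :
    (matrixUnit ζ i j : H →L[ℂ] H) = rankOne ℂ (ζ i) (ζ j) := rfl

theorem norm_matrixUnit (i j : ℕ) : ‖matrixUnit ζ i j‖ = 1 := by
  have h : ‖matrixUnit ζ i j‖ = ‖(matrixUnit ζ i j : H →L[ℂ] H)‖ := rfl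
  rw [h, coe_matrixUnit, norm_rankOne, ζ.orthonormal.1, ζ.orthonormal.1, one_mul]

theorem matrixUnit_mul_mul (T : compactOperators H) (i j k l : ℕ) :
    matrixUnit ζ i j * T * matrixUnit ζ k l =
      inner ℂ (ζ j) ((T : H →L[ℂ] H) (ζ k)) • matrixUnit ζ i l := by
  apply Subtype.ext
  ext x
  simp [coe_matrixUnit, smul_smul, mul_comm]

theorem matrixUnit_mul (i j k l : ℕ) :
    matrixUnit ζ i j * matrixUnit ζ k l = if j = k then matrixUnit ζ i l else 0 := by
  apply Subtype.ext
  ext x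
  by_cases h : j = k <;> simp [coe_matrixUnit, h, inner_basis, ζ.orthonormal.1]

theorem star_matrixUnit (i j : ℕ) : star (matrixUnit ζ i j) = matrixUnit ζ j i := by
  apply Subtype.ext
  change ContinuousLinearMap.adjoint (rankOne ℂ (ζ i) (ζ j)) = rankOne ℂ (ζ j) (ζ i)
  rw [adjoint_rankOne]

theorem isStarProjection_finiteProjection (F : Finset ℕ) :
    IsStarProjection (finiteProjection ζ F) where
  isIdempotentElem := by
    rw [IsIdempotentElem, finiteProjection, Finset.sum_mul_sum]
    refine Finset.sum_congr rfl fun i hi => ?_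
    simp_rw [matrixUnit_mul]
    rw [Finset.sum_ite_eq, if_pos hi]
  isSelfAdjoint := by
    rw [IsSelfAdjoint, finiteProjection, star_sum]
    simp_rw [star_matrixUnit]

theorem finiteProjection_mul_mul (F G : Finset ℕ) (T : compactOperators H) :
    finiteProjection ζ F * T * finiteProjection ζ G =
      ∑ i ∈ F, ∑ j ∈ G, inner ℂ (ζ i) ((T : H →L[ℂ] H) (ζ j)) • matrixUnit ζ i j := by
  simp_rw [finiteProjection, Finset.sum_mul, Finset.mul_sum, matrixUnit_mul_mul]

theorem coe_finiteProjection_apply (F : Finset ℕ) (x : H) :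
    (finiteProjection ζ F : H →L[ℂ] H) x = ∑ i ∈ F, inner ℂ (ζ i) x • ζ i := by
  have h : (finiteProjection ζ F : H →L[ℂ] H) = ∑ i ∈ F, rankOne ℂ (ζ i) (ζ i) := by
    rw [finiteProjection, AddSubmonoidClass.coe_finsetSum]
    rfl
  simp [h]

theorem finiteProjection_apply_basis (F : Finset ℕ) (n : ℕ) :
    (finiteProjection ζ F : H →L[ℂ] H) (ζ n) = if n ∈ F then ζ n else 0 := by
  simp [coe_finiteProjection_apply, inner_basis]

theorem norm_finiteProjection_le (F : Finset ℕ) : ‖finiteProjection ζ F‖ ≤ 1 := by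
  nlinarith [norm_sq_le_one_of_isStarProjection (isStarProjection_finiteProjection ζ F)]

/-- `P_n` has rank `n + 1`, whence the shift in `Finset.range`. -/
theorem basisProjection_eq (n : ℕ) :
    basisProjection ζ n = (finiteProjection ζ (Finset.range (n + 1)) : H →L[ℂ] H) := by
  ext x
  rw [basisProjection]
  have : FiniteDimensional ℂ (Submodule.span ℂ ((fun i => ζ i) '' Set.Iic n)) :=
    FiniteDimensional.span_of_finite ℂ ((Set.finite_Iic n).image _)
  refine Submodule.eq_starProjection_of_mem_of_inner_eq_zero ?_ ?_
  · rw [coe_finiteProjection_apply]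
    refine Submodule.sum_mem _ fun i hi =>
      Submodule.smul_mem _ _ (Submodule.subset_span ⟨i, ?_, rfl⟩)
    simpa [Nat.lt_succ_iff] using hi
  · intro w hw
    induction hw using Submodule.span_induction with
    | mem y hy =>
      obtain ⟨i, hi, rfl⟩ := hy
      have hi' : i < n + 1 := Nat.lt_succ_iff.2 hi
      rw [← inner_conj_symm, inner_sub_right, coe_finiteProjection_apply, inner_sum]
      simp [inner_smul_right, inner_basis, hi']
    | zero => simp
    | add y z _ _ hy hz => rw [inner_add_right, hy, hz, add_zero]
    | smul c y _ hy => rw [inner_smul_right, hy, mul_zero]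

theorem tendsto_finiteProjection_apply (x : H) :
    Tendsto (fun n => (finiteProjection ζ (Finset.range n) : H →L[ℂ] H) x) atTop (𝓝 x) := by
  have h := (ζ.hasSum_repr x).tendsto_sum_nat
  simp_rw [ζ.repr_apply_apply] at h
  simpa only [coe_finiteProjection_apply] using h

/-- Strong convergence of contractions is uniform on compact sets, and `T` maps the unit ball into a
relatively compact set; a finite `ε / 4`-net makes this quantitative. -/
theorem tendsto_finiteProjection_mul (T : compactOperators H) :
    Tendsto (fun n => finiteProjection ζ (Finset.range n) * T) atTop (𝓝 T) := by
  have hT : IsCompactOperator (T : H →L[ℂ] H) := T.2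
  have hc : IsCompact (closure ((T : H →L[ℂ] H) '' Metric.closedBall 0 1)) :=
    IsCompactOperator.isCompact_closure_image_closedBall
      (f := ((T : H →L[ℂ] H) : H →ₗ[ℂ] H)) hT 1
  rw [Metric.tendsto_atTop]
  intro ε hε
  obtain ⟨t, -, htf, ht⟩ := totallyBounded_iff_subset.1 hc.totallyBounded _
    (Metric.dist_mem_uniformity (show 0 < ε / 4 by positivity))
  have hev : ∀ᶠ n in atTop, ∀ y ∈ t,
      dist ((finiteProjection ζ (Finset.range n) : H →L[ℂ] H) y) y < ε / 4 :=
    (eventually_all_finite htf).2 fun y _ =>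
      (tendsto_finiteProjection_apply ζ y).eventually (Metric.ball_mem_nhds y (by positivity))
  obtain ⟨N, hN⟩ := eventually_atTop.1 hev
  refine ⟨N, fun n hn => ?_⟩
  set P := finiteProjection ζ (Finset.range n) with hP
  have hle : ‖(P * T - T : compactOperators H)‖ ≤ 3 * (ε / 4) := by
    change ‖((P : H →L[ℂ] H) * T - T : H →L[ℂ] H)‖ ≤ _
    refine ContinuousLinearMap.opNorm_le_of_unit_norm (by positivity) fun x hx => ?_
    have hx' : (T : H →L[ℂ] H) x ∈ closure ((T : H →L[ℂ] H) '' Metric.closedBall 0 1) :=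
      subset_closure ⟨x, by simp [hx], rfl⟩
    obtain ⟨y, hy, hxy⟩ := Set.mem_iUnion₂.1 (ht hx')
    have hxy' : ‖(T : H →L[ℂ] H) x - y‖ < ε / 4 := by simpa [dist_eq_norm] using hxy
    have hPy : ‖(P : H →L[ℂ] H) y - y‖ < ε / 4 := by
      simpa [dist_eq_norm] using hN n hn y hy
    have hPn : ‖(P : H →L[ℂ] H) ((T : H →L[ℂ] H) x - y)‖ ≤ ‖(T : H →L[ℂ] H) x - y‖ :=
      ((P : H →L[ℂ] H).le_opNorm _).trans
        (mul_le_of_le_one_left (norm_nonneg _) (norm_finiteProjection_le ζ _))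
    have e : ((P : H →L[ℂ] H) * T - T : H →L[ℂ] H) x =
        (P : H →L[ℂ] H) ((T : H →L[ℂ] H) x - y) + ((P : H →L[ℂ] H) y - y) -
          ((T : H →L[ℂ] H) x - y) := by
      simp
    rw [e]
    have h1 := norm_sub_le ((P : H →L[ℂ] H) ((T : H →L[ℂ] H) x - y) + ((P : H →L[ℂ] H) y - y))
      ((T : H →L[ℂ] H) x - y)
    have h2 := norm_add_le ((P : H →L[ℂ] H) ((T : H →L[ℂ] H) x - y)) ((P : H →L[ℂ] H) y - y)
    linarith
  rw [dist_eq_norm]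
  linarith

theorem tendsto_mul_finiteProjection (T : compactOperators H) :
    Tendsto (fun n => T * finiteProjection ζ (Finset.range n)) atTop (𝓝 T) := by
  have h := (continuous_star.tendsto _).comp (tendsto_finiteProjection_mul ζ (star T))
  rw [star_star] at h
  refine h.congr fun n => ?_
  simp [(isStarProjection_finiteProjection ζ _).isSelfAdjoint.star_eq]

end MatrixUnits

/-! ### The spectrum of an algebra generated by minimal projections -/

section MinimalProjections

variable {A : Type*} [NonUnitalCStarAlgebra A] {M : NonUnitalStarSubalgebra ℂ A}
  {e : ℕ → A} {d : ℕ → StrongDual ℂ A}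

/-- The elements `a` of `M` are the sums `∑ d n a • e n`, for a sequence `e` of elements of `M` that
is biorthogonal to the sequence `d` of functionals. -/
structure IsDiagonalSystem (M : NonUnitalStarSubalgebra ℂ A) (e : ℕ → A)
    (d : ℕ → StrongDual ℂ A) : Prop where
  mem : ∀ n, e n ∈ M
  mul_eq : ∀ a ∈ M, ∀ n, a * e n = d n a • e n
  biorthogonal : ∀ m n, d m (e n) = if m = n then 1 else 0
  tendsto : ∀ a ∈ M, Tendsto (fun n => ∑ i ∈ Finset.range n, a * e i) atTop (𝓝 a)

namespace IsDiagonalSystem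

theorem map_sum (h : IsDiagonalSystem M e d) (n : ℕ) (F : Finset ℕ) :
    d n (∑ i ∈ F, e i) = if n ∈ F then 1 else 0 := by
  rw [_root_.map_sum]
  simp_rw [h.biorthogonal]
  exact Finset.sum_ite_eq F n _

theorem map_mul (h : IsDiagonalSystem M e d) (n : ℕ) {a b : A} (ha : a ∈ M) (hb : b ∈ M) :
    d n (a * b) = d n a * d n b := by
  have h1 : d n (a * b) • e n = (d n a * d n b) • e n := by
    rw [← h.mul_eq _ (mul_mem ha hb), mul_assoc, h.mul_eq b hb, mul_smul_comm, h.mul_eq a ha,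
      smul_smul, mul_comm]
  have h2 := congrArg (d n) h1
  simpa [h.biorthogonal] using h2

/-- Each element is the limit of `∑ d i a • e i`, hence determined by its coordinates. -/
theorem eq_of_forall (h : IsDiagonalSystem M e d) {a b : A} (ha : a ∈ M) (hb : b ∈ M)
    (hab : ∀ n, d n a = d n b) : a = b := by
  refine tendsto_nhds_unique (h.tendsto a ha) ?_
  simp_rw [h.mul_eq a ha, hab, ← h.mul_eq b hb]
  exact h.tendsto b hb

/-- The `n`th coordinate, as a character. -/
def character (h : IsDiagonalSystem M e d) (n : ℕ) : spectrumOf M :=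
  ⟨StrongDual.toWeakDual ((d n).comp M.toSubmodule.subtypeL), by
    constructor
    · intro h0
      have h1 : d n (e n) = 0 := DFunLike.congr_fun h0 (⟨e n, h.mem n⟩ : M)
      simp [h.biorthogonal] at h1
    · exact fun a b => h.map_mul n a.2 b.2⟩

theorem character_apply (h : IsDiagonalSystem M e d) (n : ℕ) (a : M) :
    h.character n a = d n a := rfl

/-- Apply `χ` to `a * e n = d n a • e n` and cancel `χ (e n)`. -/
theorem eq_character (h : IsDiagonalSystem M e d) {χ : spectrumOf M} {n : ℕ}
    (hχ : χ ⟨e n, h.mem n⟩ ≠ 0) : χ = h.character n := by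
  refine WeakDual.CharacterSpace.ext fun a => ?_
  have h1 : a * ⟨e n, h.mem n⟩ = d n a • (⟨e n, h.mem n⟩ : M) :=
    Subtype.ext (h.mul_eq a a.2 n)
  have h2 := congrArg χ h1
  rw [_root_.map_mul, map_smul, smul_eq_mul] at h2
  exact mul_right_cancel₀ hχ h2

/-- A character killing every `e n` would, by continuity, kill every `a = lim ∑ a * e i`. -/
theorem exists_map_ne_zero (h : IsDiagonalSystem M e d) (χ : spectrumOf M) :
    ∃ n, χ ⟨e n, h.mem n⟩ ≠ 0 := by
  by_contra! h0
  refine χ.2.1 (DFunLike.ext _ _ fun a => ?_)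
  have h1 : Tendsto (fun n => ∑ i ∈ Finset.range n, a * (⟨e i, h.mem i⟩ : M)) atTop (𝓝 a) := by
    refine tendsto_subtype_rng.2 ((h.tendsto a a.2).congr fun n => ?_)
    rw [AddSubmonoidClass.coe_finsetSum]
    rfl
  have h2 : Tendsto (fun n => χ (∑ i ∈ Finset.range n, a * (⟨e i, h.mem i⟩ : M))) atTop
      (𝓝 (χ a)) := ((map_continuous χ).tendsto a).comp h1
  simp_rw [_root_.map_sum, _root_.map_mul, h0, mul_zero, Finset.sum_const_zero] at h2
  exact tendsto_nhds_unique h2 tendsto_const_nhds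

theorem exists_eq_character (h : IsDiagonalSystem M e d) (χ : spectrumOf M) :
    ∃ n, χ = h.character n :=
  (h.exists_map_ne_zero χ).imp fun _ => h.eq_character

/-- Compact subsets of the spectrum are finite. -/
theorem exists_finset_of_isCompact (h : IsDiagonalSystem M e d) {K : Set (spectrumOf M)}
    (hK : IsCompact K) : ∃ F : Finset ℕ, ∀ n, n ∈ F ↔ h.character n ∈ K := by
  classical
  -- By `eq_character` these open sets contain only `h.character n`, so the spectrum is discrete and
  -- a finite subcover enumerates `K`.
  have hopen : ∀ n, IsOpen {χ : spectrumOf M | χ ⟨e n, h.mem n⟩ ≠ 0} := fun n =>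
    isOpen_ne_fun ((WeakDual.eval_continuous (⟨e n, h.mem n⟩ : M)).comp
      continuous_subtype_val) continuous_const
  obtain ⟨t, ht⟩ := hK.elim_finite_subcover _ hopen fun χ _ =>
    Set.mem_iUnion.2 (h.exists_map_ne_zero χ)
  refine ⟨t.filter fun n => h.character n ∈ K, fun n => ?_⟩
  rw [Finset.mem_filter, and_iff_right_iff_imp]
  intro hn
  obtain ⟨m, hm, hmn⟩ := Set.mem_iUnion₂.1 (ht hn)
  have h1 : d n (e m) ≠ 0 := hmn
  have h2 : n = m := by simpa [h.biorthogonal] using h1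
  exact h2 ▸ hm

/-- The indicator function of a compact subset of the spectrum is a finite projection. -/
theorem exists_indicator_eq (h : IsDiagonalSystem M e d) {K : Set (spectrumOf M)}
    (hK : IsCompact K) : ∃ F : Finset ℕ, indicator M K =
      NormedSpace.inclusionInDoubleDual ℂ A (∑ i ∈ F, e i) := by
  obtain ⟨F, hF⟩ := h.exists_finset_of_isCompact hK
  refine ⟨F, ?_⟩
  obtain ⟨p, hp⟩ : ∃ p : M, (p : A) = ∑ i ∈ F, e i := ⟨⟨_, sum_mem fun i _ => h.mem i⟩, rfl⟩
  have hev : ∀ n, h.character n p = if n ∈ F then 1 else 0 := fun n => by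
    rw [character_apply, hp, h.map_sum]
  have hpl : p ∈ plateauFunctions M K := by
    constructor
    · intro χ
      obtain ⟨n, rfl⟩ := h.exists_eq_character χ
      rw [hev]
      split_ifs <;> simp
    · intro χ hχ
      obtain ⟨n, rfl⟩ := h.exists_eq_character χ
      rw [hev, if_pos ((hF n).2 hχ)]
  -- `p` is itself a plateau function, and the least one: any other is `1` on `K` and nonnegative
  -- elsewhere. The decreasing net thus ends at `p`.
  have hfilter : plateauFilter M K = pure p := by
    apply le_antisymm
    · refine (iInf₂_le p hpl).trans ?_
      rw [← principal_singleton, principal_mono]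
      rintro g ⟨hg, hgp⟩
      refine Subtype.ext (h.eq_of_forall g.2 p.2 fun n => ?_)
      rw [← h.character_apply, ← h.character_apply]
      by_cases hn : n ∈ F
      · rw [hg.2 _ ((hF n).1 hn), hev, if_pos hn]
      · have h1 := hgp (h.character n)
        obtain ⟨h2, -, h3⟩ := hg.1 (h.character n)
        rw [hev, if_neg hn] at h1
        rw [hev, if_neg hn]
        exact Complex.ext (le_antisymm h1 h2) h3
    · refine le_iInf₂ fun f hf => ?_
      rw [pure_le_principal]
      refine ⟨hpl, fun χ => ?_⟩
      obtain ⟨n, rfl⟩ := h.exists_eq_character χ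
      rw [hev]
      split_ifs with hn
      · rw [hf.2 _ ((hF n).1 hn)]
      · exact (hf.1 _).1
  rw [indicator, hfilter, Tendsto.limUnder_eq (tendsto_pure_nhds _ p), hp]
  rfl

end IsDiagonalSystem

end MinimalProjections

/-! ### The diagonal compact operators -/

section Diagonal

variable {H : Type*} [NormedAddCommGroup H] [InnerProductSpace ℂ H] [CompleteSpace H]
  (ζ : HilbertBasis ℕ ℂ H)

theorem diagonal_apply {T : compactOperators H} (hT : T ∈ diagonalCompacts ζ) (n : ℕ) :
    (T : H →L[ℂ] H) (ζ n) = inner ℂ (ζ n) ((T : H →L[ℂ] H) (ζ n)) • ζ n := by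
  obtain ⟨c, hc⟩ := hT n
  rw [hc, inner_smul_right, inner_basis, if_pos rfl, mul_one]

theorem matrixUnit_mem_diagonalCompacts (n : ℕ) : matrixUnit ζ n n ∈ diagonalCompacts ζ := by
  intro m
  refine ⟨if n = m then 1 else 0, ?_⟩
  by_cases h : n = m <;> simp [coe_matrixUnit, inner_basis, h, ζ.orthonormal.1]

theorem finiteProjection_mem_diagonalCompacts (F : Finset ℕ) :
    finiteProjection ζ F ∈ diagonalCompacts ζ :=
  sum_mem fun n _ => matrixUnit_mem_diagonalCompacts ζ n

theorem diagonal_mul_matrixUnit {T : compactOperators H} (hT : T ∈ diagonalCompacts ζ) (n : ℕ) :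
    T * matrixUnit ζ n n = inner ℂ (ζ n) ((T : H →L[ℂ] H) (ζ n)) • matrixUnit ζ n n := by
  apply Subtype.ext
  ext x
  change (T : H →L[ℂ] H) (rankOne ℂ (ζ n) (ζ n) x) =
    (inner ℂ (ζ n) ((T : H →L[ℂ] H) (ζ n)) : ℂ) • rankOne ℂ (ζ n) (ζ n) x
  rw [rankOne_apply, map_smul, smul_comm, ← diagonal_apply ζ hT]

theorem diagonal_mul_finiteProjection {T : compactOperators H} (hT : T ∈ diagonalCompacts ζ)
    (F : Finset ℕ) : T * finiteProjection ζ F =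
      ∑ n ∈ F, inner ℂ (ζ n) ((T : H →L[ℂ] H) (ζ n)) • matrixUnit ζ n n := by
  simp_rw [finiteProjection, Finset.mul_sum, diagonal_mul_matrixUnit ζ hT]

theorem ext_basis {S T : compactOperators H}
    (h : ∀ n, (S : H →L[ℂ] H) (ζ n) = (T : H →L[ℂ] H) (ζ n)) : S = T := by
  have e : ∀ n, S * finiteProjection ζ (Finset.range n) =
      T * finiteProjection ζ (Finset.range n) := by
    intro n
    apply Subtype.ext
    ext x
    change (S : H →L[ℂ] H) ((finiteProjection ζ (Finset.range n) : H →L[ℂ] H) x) =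
      (T : H →L[ℂ] H) ((finiteProjection ζ (Finset.range n) : H →L[ℂ] H) x)
    simp only [coe_finiteProjection_apply, map_sum, map_smul, h]
  refine tendsto_nhds_unique (tendsto_mul_finiteProjection ζ S) ?_
  simp_rw [e]
  exact tendsto_mul_finiteProjection ζ T

/-- The eigenvalue is a continuous function of `T`, namely its diagonal entry, so the existential
becomes a closed equation. -/
theorem isClosed_diagonalCompacts :
    IsClosed (diagonalCompacts ζ : Set (compactOperators H)) := by
  have h : (diagonalCompacts ζ : Set (compactOperators H)) =
      ⋂ n, {T : compactOperators H |
        (T : H →L[ℂ] H) (ζ n) = inner ℂ (ζ n) ((T : H →L[ℂ] H) (ζ n)) • ζ n} := by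
    ext T
    simp only [Set.mem_iInter]
    exact ⟨fun hT n => diagonal_apply ζ hT n, fun hT n => ⟨_, hT n⟩⟩
  rw [h]
  refine isClosed_iInter fun n => ?_
  have hc : Continuous fun T : compactOperators H => (T : H →L[ℂ] H) (ζ n) :=
    (ContinuousLinearMap.apply ℂ H (ζ n)).continuous.comp continuous_subtype_val
  exact isClosed_eq hc ((continuous_const.inner hc).smul continuous_const)

theorem mul_comm_of_mem_diagonalCompacts {S T : compactOperators H}
    (hS : S ∈ diagonalCompacts ζ) (hT : T ∈ diagonalCompacts ζ) : S * T = T * S := by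
  refine ext_basis ζ fun n => ?_
  change (S : H →L[ℂ] H) ((T : H →L[ℂ] H) (ζ n)) = (T : H →L[ℂ] H) ((S : H →L[ℂ] H) (ζ n))
  obtain ⟨c, hc⟩ := hS n
  obtain ⟨d, hd⟩ := hT n
  rw [hc, hd, map_smul, map_smul, hc, hd, smul_comm]

theorem isTopography_diagonalCompacts : IsTopography (diagonalCompacts ζ) where
  isClosed := isClosed_diagonalCompacts ζ
  comm _ hS _ hT := mul_comm_of_mem_diagonalCompacts ζ hS hT
  exists_approximateUnit := by
    refine ⟨map (fun n => finiteProjection ζ (Finset.range n)) atTop, ?_, ?_⟩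
    · exact
        { tendsto_mul_left := fun T => tendsto_map'_iff.2 (tendsto_mul_finiteProjection ζ T)
          tendsto_mul_right := fun T => tendsto_map'_iff.2 (tendsto_finiteProjection_mul ζ T)
          neBot := inferInstance }
    · exact eventually_map.2 (Eventually.of_forall fun n =>
        finiteProjection_mem_diagonalCompacts ζ _)

theorem diagonalCompacts_eq_topologicalClosure_adjoin :
    diagonalCompacts ζ =
      (NonUnitalStarAlgebra.adjoin ℂ {T : compactOperators H |
        ∃ n, (T : H →L[ℂ] H) = basisProjection ζ n}).topologicalClosure := by
  apply le_antisymm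
  · intro T hT
    set B := NonUnitalStarAlgebra.adjoin ℂ {T : compactOperators H |
      ∃ n, (T : H →L[ℂ] H) = basisProjection ζ n} with hB
    -- The case `n = 0` is the empty sum; `n + 1` corresponds to the generator `P_n`.
    have hP : ∀ n, finiteProjection ζ (Finset.range n) ∈ B := by
      intro n
      cases n with
      | zero => simp [finiteProjection, zero_mem]
      | succ n =>
        exact NonUnitalStarAlgebra.subset_adjoin ℂ _ ⟨n, (basisProjection_eq ζ n).symm⟩
    have hE : ∀ n, matrixUnit ζ n n ∈ B := by
      intro n
      have h := sub_mem (hP (n + 1)) (hP n)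
      rwa [finiteProjection, finiteProjection, Finset.sum_range_succ, add_sub_cancel_left] at h
    have hTP : ∀ n, T * finiteProjection ζ (Finset.range n) ∈ (B : Set (compactOperators H)) := by
      intro n
      rw [diagonal_mul_finiteProjection ζ hT]
      exact sum_mem fun i _ => SMulMemClass.smul_mem _ (hE i)
    exact mem_closure_of_tendsto (tendsto_mul_finiteProjection ζ T) (Eventually.of_forall hTP)
  · refine NonUnitalStarSubalgebra.topologicalClosure_minimal _ ?_ (isClosed_diagonalCompacts ζ)
    refine NonUnitalStarAlgebra.adjoin_le ?_
    rintro T ⟨n, hn⟩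
    have : T = finiteProjection ζ (Finset.range (n + 1)) :=
      Subtype.ext (hn.trans (basisProjection_eq ζ n))
    rw [this]
    exact finiteProjection_mem_diagonalCompacts ζ _

/-- The `n`th diagonal entry, as a functional on the compact operators. -/
def diagonalEntry (n : ℕ) : StrongDual ℂ (compactOperators H) :=
  LinearMap.mkContinuous
    { toFun := fun T => inner ℂ (ζ n) ((T : H →L[ℂ] H) (ζ n))
      map_add' := fun S T => by simp
      map_smul' := fun c T => by simp } 1 fun T => by
    refine (norm_inner_le_norm _ _).trans ?_
    rw [ζ.orthonormal.1, one_mul, one_mul]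
    refine (ContinuousLinearMap.le_opNorm _ _).trans ?_
    rw [ζ.orthonormal.1, mul_one]
    rfl

theorem diagonalEntry_apply (n : ℕ) (T : compactOperators H) :
    diagonalEntry ζ n T = inner ℂ (ζ n) ((T : H →L[ℂ] H) (ζ n)) := rfl

theorem isDiagonalSystem_diagonalCompacts :
    IsDiagonalSystem (diagonalCompacts ζ) (fun n => matrixUnit ζ n n) (diagonalEntry ζ) where
  mem := matrixUnit_mem_diagonalCompacts ζ
  mul_eq _ hT n := diagonal_mul_matrixUnit ζ hT n
  biorthogonal m n := by
    rw [diagonalEntry_apply, coe_matrixUnit, rankOne_apply, inner_smul_right, inner_basis,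
      inner_basis]
    by_cases h : m = n <;> simp [h]
  tendsto T _ := by
    simpa only [finiteProjection, Finset.mul_sum] using tendsto_mul_finiteProjection ζ T

end Diagonal

/-! ### States supported by a projection -/

section Supported

variable {A : Type*} [NonUnitalCStarAlgebra A]

/-- A state that is `1` at a projection takes real values at self-adjoint elements. -/
theorem im_map_eq_zero {φ : StrongDual ℂ A} (hφ : φ ∈ stateSpace A) {p : A}
    (hp : IsStarProjection p) (hφp : φ p = 1) {a : A} (ha : IsSelfAdjoint a) : (φ a).im = 0 := by
  set x := p * a * p with hx
  have hxs : star x = x := by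
    rw [hx, star_mul, star_mul, hp.isSelfAdjoint.star_eq, ha.star_eq, mul_assoc]
  have hpx : p * x = x := by rw [hx, ← mul_assoc, ← mul_assoc, hp.isIdempotentElem.eq]
  have hxp : x * p = x := by rw [hx, mul_assoc, hp.isIdempotentElem.eq]
  -- `(p + x)² = p + 2x + x²`. Positivity makes `φ` real at this square and at `x²`, hence at `x`.
  have h1 := (hφ.1 (p + x)).2
  have h2 := (hφ.1 x).2
  rw [star_add, hp.isSelfAdjoint.star_eq, hxs, add_mul, mul_add, mul_add,
    hp.isIdempotentElem.eq, hpx, hxp, map_add, map_add, map_add, hφp] at h1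
  rw [hxs] at h2
  rw [map_eq_map_mul_mul hφ.2.le hp hφp a, ← hx]
  simp only [Complex.add_im, Complex.one_im, h2] at h1
  linarith

/-- If `1_K` is an element of `A`, then so is `1_K u 1_K`. -/
theorem cutDown_apply_of_indicator_eq {M : NonUnitalStarSubalgebra ℂ A} {K : Set (spectrumOf M)}
    {p : A} (hp : IsStarProjection p)
    (hK : indicator M K = NormedSpace.inclusionInDoubleDual ℂ A p) (u : Unitization ℂ A)
    (φ : StrongDual ℂ A) : cutDown M K u φ = u.fst * φ p + φ (p * u.snd * p) := by
  rw [cutDown, hK, arensMul_inclusion, arensMul_inclusion, arensMul_inclusion,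
    hp.isIdempotentElem.eq]
  rfl

variable {M : NonUnitalStarSubalgebra ℂ A} {e : ℕ → A} {d : ℕ → StrongDual ℂ A}
  {L : selfAdjoint (Unitization ℂ A) → ℝ≥0∞}

theorem IsDiagonalSystem.isRegular (h : IsDiagonalSystem M e d)
    (hL : ∀ F : Finset ℕ, ∃ C : ℝ, ∀ φ ∈ stateSpace A, φ (∑ i ∈ F, e i) = 1 →
      ∀ a : selfAdjoint A, L (selfAdjointInr a) ≤ 1 → ‖φ (a : A)‖ ≤ C) : IsRegular L M := by
  intro K
  obtain ⟨F, hF⟩ := h.exists_indicator_eq K.isCompact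
  obtain ⟨C, hC⟩ := hL F
  have hb : ∀ φ ∈ statesOn M (K : Set (spectrumOf M)), ∀ a : selfAdjoint A,
      L (selfAdjointInr a) ≤ 1 → ‖φ (a : A)‖ ≤ C := by
    intro φ hφ a ha
    have h1 := hφ.2
    rw [hF] at h1
    exact hC φ hφ.1 h1 a ha
  refine lt_of_le_of_lt (b := ENNReal.ofReal (C + C)) ?_ ENNReal.ofReal_lt_top
  refine iSup₂_le fun φ hφ => iSup₂_le fun ψ hψ => iSup₂_le fun a ha => ?_
  rw [← ofReal_norm]
  exact ENNReal.ofReal_le_ofReal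
    ((norm_sub_le _ _).trans (add_le_add (hb φ hφ a ha) (hb ψ hψ a ha)))

/-- Tameness in terms of finite projections. -/
theorem IsDiagonalSystem.exists_of_isTame (h : IsDiagonalSystem M e d)
    (he : ∀ F : Finset ℕ, IsStarProjection (∑ i ∈ F, e i)) {S : Set (StrongDual ℂ A)}
    (hS : IsTame L M S) : ∃ μ ∈ stateSpace A, ∃ G : Finset ℕ, μ (∑ i ∈ G, e i) = 1 ∧
      ∀ δ : ℝ, 0 < δ → ∃ F : Finset ℕ, ∀ φ ∈ S, ∀ u ∈ lipschitzBall L μ,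
        ‖unitalExtension φ (u : Unitization ℂ A) -
          ((u : Unitization ℂ A).fst * φ (∑ i ∈ F, e i) +
            φ ((∑ i ∈ F, e i) * (u : Unitization ℂ A).snd * ∑ i ∈ F, e i))‖ ≤ δ := by
  obtain ⟨-, μ, hμ, hlim⟩ := hS
  obtain ⟨K, hK⟩ := Set.mem_iUnion.1 hμ
  obtain ⟨G, hG⟩ := h.exists_indicator_eq K.isCompact
  have hμG := hK.2
  rw [hG] at hμG
  refine ⟨μ, hK.1, G, hμG, fun δ hδ => ?_⟩
  -- One compact set per `δ` suffices.
  obtain ⟨K', hK'⟩ := (hlim.eventually (Iic_mem_nhds (ENNReal.ofReal_pos.2 hδ))).exists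
  obtain ⟨F, hF⟩ := h.exists_indicator_eq K'.isCompact
  refine ⟨F, fun φ hφ u hu => ?_⟩
  have h1 := (le_iSup₂_of_le φ hφ (le_iSup₂_of_le u hu le_rfl)).trans hK'
  rw [cutDown_apply_of_indicator_eq (he F) hF, ← ofReal_norm] at h1
  exact (ENNReal.ofReal_le_ofReal_iff hδ.le).1 h1

/-- If `L` is finite, then the topology of the Monge-Kantorovich metric is finer than the weak*
topology. -/
theorem continuous_toWeakDual_of_edist_eq {X : Type*} [PseudoEMetricSpace X]
    {f : X → StrongDual ℂ A} (hf : ∀ x y, edist x y = mongeKantorovich L (f x) (f y))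
    (hL : ∀ a : selfAdjoint A, ∃ C : ℝ, 0 < C ∧ L (selfAdjointInr (C⁻¹ • a)) ≤ 1) :
    Continuous fun x => StrongDual.toWeakDual (f x) := by
  have hsa : ∀ a : selfAdjoint A, Continuous fun x => f x (a : A) := by
    intro a
    obtain ⟨C, hC, hLC⟩ := hL a
    refine LipschitzWith.continuous (K := C.toNNReal) fun φ ψ => ?_
    have h1 : ‖f φ ((C⁻¹ • a : selfAdjoint A) : A) -
        f ψ ((C⁻¹ • a : selfAdjoint A) : A)‖ₑ ≤ edist φ ψ := by
      rw [hf]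
      exact le_iSup₂ (f := fun (a : selfAdjoint A) (_ : L (selfAdjointInr a) ≤ 1) =>
        ‖f φ (a : A) - f ψ (a : A)‖ₑ) (C⁻¹ • a) hLC
    have h2 : (a : A) = (C : ℂ) • ((C⁻¹ • a : selfAdjoint A) : A) := by
      have h3 : ((C⁻¹ • a : selfAdjoint A) : A) = ((C⁻¹ : ℝ) : ℂ) • (a : A) := by
        rw [Complex.coe_smul]
        rfl
      rw [h3, smul_smul, ← Complex.ofReal_mul, mul_inv_cancel₀ hC.ne', Complex.ofReal_one, one_smul]
    rw [edist_eq_enorm_sub, h2, map_smul, map_smul, ← smul_sub, enorm_smul]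
    have h4 : ‖(C : ℂ)‖ₑ = (C.toNNReal : ℝ≥0∞) := by
      rw [← ofReal_norm, Complex.norm_real, Real.norm_of_nonneg hC.le]
      rfl
    rw [h4]
    gcongr
  refine WeakDual.continuous_of_continuous_eval fun a => ?_
  -- The metric only tests self-adjoint elements; the others are reached through real and imaginary
  -- parts.
  have h1 : ∀ φ, f φ a =
      f φ (realPart a : A) +
        Complex.I * f φ (imaginaryPart a : A) := by
    intro φ
    conv_lhs => rw [← realPart_add_I_smul_imaginaryPart a]
    rw [map_add, map_smul, smul_eq_mul]
  change Continuous fun x => f x a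
  simp_rw [h1]
  exact (hsa _).add (continuous_const.mul (hsa _))

/-- The topology and the metric are explicit arguments because the two compared topologies live on
the same type. -/
theorem topology_le_of_eventually_edist_lt {X : Type*} (t : TopologicalSpace X)
    (m : PseudoEMetricSpace X)
    (h : ∀ (x : X) (ε : ℝ≥0∞), 0 < ε → ∀ᶠ y in @nhds X t x, m.edist y x < ε) :
    t ≤ m.toUniformSpace.toTopologicalSpace :=
  le_of_nhds_le_nhds fun x => Metric.nhds_basis_eball.ge_iff.2 fun ε hε => h x ε hε

end Supported

/-! ### The weighted seminorm -/

section WeightedSeminorm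

variable {H : Type*} [NormedAddCommGroup H] [InnerProductSpace ℂ H] [CompleteSpace H]
  {ζ : HilbertBasis ℕ ℂ H} {ω : ℕ → ℝ} {α : ℝ}

/-- Compressing by `P_n` leaves this entry unchanged, as `P_n` is self-adjoint and fixes `ζ i` and
`ζ j`. -/
theorem norm_inner_le_norm_basisProjection (T : H →L[ℂ] H) {i j n : ℕ} (hi : i ≤ n)
    (hj : j ≤ n) :
    ‖(inner ℂ (ζ i) (T (ζ j)) : ℂ)‖ ≤ ‖basisProjection ζ n * T * basisProjection ζ n‖ := by
  have hPj : basisProjection ζ n (ζ j) = ζ j := by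
    rw [basisProjection_eq, finiteProjection_apply_basis, if_pos]
    exact Finset.mem_range.2 (Nat.lt_succ_of_le hj)
  have hPi : ∀ y, (inner ℂ (ζ i) (basisProjection ζ n y) : ℂ) = inner ℂ (ζ i) y := by
    intro y
    have hi' : i < n + 1 := Nat.lt_succ_of_le hi
    rw [basisProjection_eq, coe_finiteProjection_apply, inner_sum]
    simp [inner_smul_right, inner_basis, hi']
  have e : (inner ℂ (ζ i) (T (ζ j)) : ℂ) =
      inner ℂ (ζ i) ((basisProjection ζ n * T * basisProjection ζ n) (ζ j)) := by
    rw [mul_apply_eq_comp, mul_apply_eq_comp, hPi, hPj]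
  rw [e]
  refine (norm_inner_le_norm _ _).trans ?_
  rw [ζ.orthonormal.1, one_mul]
  refine (ContinuousLinearMap.le_opNorm _ _).trans ?_
  rw [ζ.orthonormal.1, mul_one]

theorem norm_basisProjection_le (n : ℕ) : ‖basisProjection ζ n‖ ≤ 1 := by
  rw [basisProjection_eq]
  exact norm_finiteProjection_le ζ _

theorem norm_compression_le (T : compactOperators H) (n : ℕ) :
    ‖basisProjection ζ n * (T : H →L[ℂ] H) * basisProjection ζ n‖ ≤ ‖T‖ := by
  have h1 := norm_mul_le (basisProjection ζ n * (T : H →L[ℂ] H)) (basisProjection ζ n)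
  have h2 := norm_mul_le (basisProjection ζ n) (T : H →L[ℂ] H)
  have h3 := norm_basisProjection_le (ζ := ζ) n
  have h4 : ‖T‖ = ‖(T : H →L[ℂ] H)‖ := rfl
  rw [h4]
  exact h1.trans ((mul_le_of_le_one_right (norm_nonneg _) h3).trans
    (h2.trans (mul_le_of_le_one_left (norm_nonneg _) h3)))

/-- The lower bound on the weights makes `L` finite everywhere, which gives both the dense domain
and the comparison of the metric with the weak* topology. -/
theorem weightedSeminorm_le (hα : 0 < α) (hω : ∀ n, α ≤ ω n) (T : compactOperators H) :
    weightedSeminorm ζ ω T ≤ ENNReal.ofReal (α⁻¹ * ‖T‖) := by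
  refine iSup_le fun n => ENNReal.ofReal_le_ofReal ?_
  exact mul_le_mul (inv_anti₀ hα (hω n)) (norm_compression_le T n) (norm_nonneg _)
    (inv_nonneg.2 hα.le)

theorem weightedSeminorm_smul (r : ℝ) (T : compactOperators H) :
    weightedSeminorm ζ ω ((r : ℂ) • T) = ENNReal.ofReal |r| * weightedSeminorm ζ ω T := by
  rw [weightedSeminorm, weightedSeminorm, ENNReal.mul_iSup]
  refine iSup_congr fun n => ?_
  have h : (((r : ℂ) • T : compactOperators H) : H →L[ℂ] H) = (r : ℂ) • (T : H →L[ℂ] H) := rfl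
  rw [h, mul_smul_comm, smul_mul_assoc, norm_smul, Complex.norm_real, Real.norm_eq_abs,
    ← ENNReal.ofReal_mul (abs_nonneg r), mul_left_comm]

theorem weightedSeminorm_add_le (hα : 0 < α) (hω : ∀ n, α ≤ ω n) (S T : compactOperators H) :
    weightedSeminorm ζ ω (S + T) ≤ weightedSeminorm ζ ω S + weightedSeminorm ζ ω T := by
  refine iSup_le fun n => ?_
  have h : ((S + T : compactOperators H) : H →L[ℂ] H) = (S : H →L[ℂ] H) + (T : H →L[ℂ] H) := rfl
  have hn : 0 ≤ (ω n)⁻¹ := inv_nonneg.2 (hα.le.trans (hω n))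
  rw [h, mul_add, add_mul]
  refine le_trans (ENNReal.ofReal_le_ofReal
    (mul_le_mul_of_nonneg_left (norm_add_le _ _) hn)) ?_
  rw [mul_add]
  refine ENNReal.ofReal_add_le.trans (add_le_add ?_ ?_)
  · exact le_iSup (fun n => ENNReal.ofReal
      ((ω n)⁻¹ * ‖basisProjection ζ n * (S : H →L[ℂ] H) * basisProjection ζ n‖)) n
  · exact le_iSup (fun n => ENNReal.ofReal
      ((ω n)⁻¹ * ‖basisProjection ζ n * (T : H →L[ℂ] H) * basisProjection ζ n‖)) n

/-- Used with `c = 1` for the Lipschitz ball and with `c = 0` for the kernel of `L`. -/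
theorem norm_compression_le_of_weightedSeminorm_le (hα : 0 < α) (hω : ∀ n, α ≤ ω n)
    {T : compactOperators H} {c : ℝ} (hc : 0 ≤ c)
    (hT : weightedSeminorm ζ ω T ≤ ENNReal.ofReal c) (n : ℕ) :
    ‖basisProjection ζ n * (T : H →L[ℂ] H) * basisProjection ζ n‖ ≤ ω n * c := by
  have h := (ENNReal.ofReal_le_ofReal_iff hc).1 ((le_iSup (fun n => ENNReal.ofReal
    ((ω n)⁻¹ * ‖basisProjection ζ n * (T : H →L[ℂ] H) * basisProjection ζ n‖)) n).trans hT)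
  exact (inv_mul_le_iff₀ (hα.trans_le (hω n))).1 h

theorem norm_inner_le_of_weightedSeminorm_le_one (hα : 0 < α) (hω : ∀ n, α ≤ ω n)
    {T : compactOperators H} (hT : weightedSeminorm ζ ω T ≤ 1) (i j : ℕ) :
    ‖(inner ℂ (ζ i) ((T : H →L[ℂ] H) (ζ j)) : ℂ)‖ ≤ ω (max i j) := by
  have h := norm_compression_le_of_weightedSeminorm_le hα hω zero_le_one
    (hT.trans_eq ENNReal.ofReal_one.symm) (max i j)
  rw [mul_one] at h
  exact (norm_inner_le_norm_basisProjection _ (le_max_left i j) (le_max_right i j)).trans h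

/-- All matrix entries vanish, hence all finite corners, and `T` is recovered by letting the
projections grow on the left, then on the right. -/
theorem eq_zero_of_weightedSeminorm_eq_zero (hα : 0 < α) (hω : ∀ n, α ≤ ω n)
    {T : compactOperators H} (hT : weightedSeminorm ζ ω T = 0) : T = 0 := by
  have hent : ∀ i j, (inner ℂ (ζ i) ((T : H →L[ℂ] H) (ζ j)) : ℂ) = 0 := by
    intro i j
    have h := norm_compression_le_of_weightedSeminorm_le hα hω le_rfl
      (hT.trans ENNReal.ofReal_zero.symm).le (max i j)
    rw [mul_zero] at h
    exact norm_le_zero_iff.1 ((norm_inner_le_norm_basisProjection _ (le_max_left i j)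
      (le_max_right i j)).trans h)
  have hFG : ∀ F G, finiteProjection ζ F * (T * finiteProjection ζ G) = 0 := by
    intro F G
    rw [← mul_assoc, finiteProjection_mul_mul]
    simp [hent]
  have hG : ∀ G, T * finiteProjection ζ G = 0 := by
    intro G
    have h := tendsto_finiteProjection_mul ζ (T * finiteProjection ζ G)
    simp_rw [hFG] at h
    exact tendsto_nhds_unique h tendsto_const_nhds
  have h := tendsto_mul_finiteProjection ζ T
  simp_rw [hG] at h
  exact tendsto_nhds_unique h tendsto_const_nhds

/-- A unit would be the norm limit of the finite projections, whose consecutive differences have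
norm `1`. -/
theorem compactOperators_nonunital (ζ : HilbertBasis ℕ ℂ H) :
    ¬ ∃ e : compactOperators H, ∀ a : compactOperators H, e * a = a ∧ a * e = a := by
  rintro ⟨e, he⟩
  have h1 := tendsto_finiteProjection_mul ζ e
  simp_rw [fun n => (he (finiteProjection ζ (Finset.range n))).2] at h1
  have h2 := (h1.comp (tendsto_add_atTop_nat 1)).sub h1
  rw [sub_self] at h2
  have h3 : ∀ n, finiteProjection ζ (Finset.range (n + 1)) -
      finiteProjection ζ (Finset.range n) = matrixUnit ζ n n := by
    intro n
    rw [finiteProjection, finiteProjection, Finset.sum_range_succ, add_sub_cancel_left]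
  have h4 := h2.norm
  simp only [Function.comp_apply, h3, norm_matrixUnit, norm_zero] at h4
  exact one_ne_zero (tendsto_nhds_unique tendsto_const_nhds h4)

theorem isLipschitzPair_weightedSeminorm (hα : 0 < α) (hω : ∀ n, α ≤ ω n) :
    IsLipschitzPair (extendToUnitization (weightedSeminorm ζ ω)) where
  nonunital := compactOperators_nonunital ζ
  smul r u := weightedSeminorm_smul r (u : Unitization ℂ (compactOperators H)).snd
  add_le u v := weightedSeminorm_add_le hα hω _ _
  dense_domain := by
    have h : {u : selfAdjoint (Unitization ℂ (compactOperators H)) |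
        extendToUnitization (weightedSeminorm ζ ω) u < ∞} = Set.univ :=
      Set.eq_univ_of_forall fun u =>
        (weightedSeminorm_le hα hω _).trans_lt ENNReal.ofReal_lt_top
    rw [h]
    exact dense_univ
  eq_zero_iff u := by
    constructor
    · intro h
      have hs : (u : Unitization ℂ (compactOperators H)).snd = 0 :=
        eq_zero_of_weightedSeminorm_eq_zero hα hω h
      have hr : star (u : Unitization ℂ (compactOperators H)).fst =
          (u : Unitization ℂ (compactOperators H)).fst :=
        congrArg (fun v : Unitization ℂ (compactOperators H) => v.fst) (selfAdjoint.mem_iff.1 u.2)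
      refine ⟨(u : Unitization ℂ (compactOperators H)).fst.re, Unitization.ext ?_ ?_⟩
      · simpa using (Complex.conj_eq_iff_re.1 hr).symm
      · simpa using hs
    · rintro ⟨r, hr⟩
      have hs : (u : Unitization ℂ (compactOperators H)).snd = 0 := by simp [hr]
      refine le_antisymm ?_ zero_le
      refine (weightedSeminorm_le hα hω _).trans ?_
      rw [hs]
      simp

/-! ### Regularity and the topology of tame sets -/

theorem norm_map_le_of_supported (hα : 0 < α) (hω : ∀ n, α ≤ ω n)
    {φ : StrongDual ℂ (compactOperators H)} (hφ : ‖φ‖ ≤ 1) {F : Finset ℕ}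
    (hF : φ (finiteProjection ζ F) = 1) {T : compactOperators H}
    (hT : weightedSeminorm ζ ω T ≤ 1) : ‖φ T‖ ≤ ∑ i ∈ F, ∑ j ∈ F, ω (max i j) := by
  rw [map_eq_map_mul_mul hφ (isStarProjection_finiteProjection ζ F) hF, finiteProjection_mul_mul,
    map_sum]
  refine norm_sum_le_of_le _ fun i _ => ?_
  rw [map_sum]
  refine norm_sum_le_of_le _ fun j _ => ?_
  rw [map_smul, smul_eq_mul, norm_mul]
  have h1 : ‖φ (matrixUnit ζ i j)‖ ≤ 1 := by
    refine (φ.le_opNorm _).trans ?_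
    rwa [norm_matrixUnit, mul_one]
  exact (mul_le_of_le_one_right (norm_nonneg _) h1).trans
    (norm_inner_le_of_weightedSeminorm_le_one hα hω hT i j)

theorem isRegular_weightedSeminorm (hα : 0 < α) (hω : ∀ n, α ≤ ω n) :
    IsRegular (extendToUnitization (weightedSeminorm ζ ω)) (diagonalCompacts ζ) :=
  (isDiagonalSystem_diagonalCompacts ζ).isRegular fun _ =>
    ⟨_, fun _ hφ hF _ ha => norm_map_le_of_supported hα hω hφ.2.le hF ha⟩

/-- The right-hand side does not depend on `T`: on a corner, finitely many evaluations control the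
whole Lipschitz ball. -/
theorem dist_map_compression_le (hα : 0 < α) (hω : ∀ n, α ≤ ω n)
    (φ ψ : StrongDual ℂ (compactOperators H)) (F : Finset ℕ) {T : compactOperators H}
    (hT : weightedSeminorm ζ ω T ≤ 1) :
    ‖φ (finiteProjection ζ F * T * finiteProjection ζ F) -
        ψ (finiteProjection ζ F * T * finiteProjection ζ F)‖ ≤
      ∑ i ∈ F, ∑ j ∈ F, ω (max i j) * ‖φ (matrixUnit ζ i j) - ψ (matrixUnit ζ i j)‖ := by
  rw [finiteProjection_mul_mul]
  simp_rw [map_sum, ← Finset.sum_sub_distrib]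
  refine norm_sum_le_of_le _ fun i _ => norm_sum_le_of_le _ fun j _ => ?_
  rw [map_smul, map_smul, ← smul_sub, norm_smul]
  exact mul_le_mul_of_nonneg_right (norm_inner_le_of_weightedSeminorm_le_one hα hω hT i j)
    (norm_nonneg _)

/-- The normalization of a self-adjoint element with respect to a state which is real at it. -/
theorem exists_mem_lipschitzBall {μ : StrongDual ℂ (compactOperators H)}
    (T : selfAdjoint (compactOperators H))
    (hμ : (μ (T : compactOperators H)).im = 0)
    (hT : extendToUnitization (weightedSeminorm ζ ω) (selfAdjointInr T) ≤ 1) :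
    ∃ u ∈ lipschitzBall (extendToUnitization (weightedSeminorm ζ ω)) μ,
      (u : Unitization ℂ (compactOperators H)).fst = -μ (T : compactOperators H) ∧
      (u : Unitization ℂ (compactOperators H)).snd = T := by
  -- The element is `T - μ(T) 1`: self-adjoint since `μ(T)` is real, and `L` ignores the scalar
  -- part.
  refine ⟨⟨Unitization.inl (-μ (T : compactOperators H)) +
    ((T : compactOperators H) : Unitization ℂ (compactOperators H)), ?_⟩, ⟨?_, ?_⟩, ?_, ?_⟩
  · rw [selfAdjoint.mem_iff, star_add, ← Unitization.inr_star, ← Unitization.inl_star,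
      selfAdjoint.mem_iff.1 T.2, star_neg]
    congr 3
    exact Complex.conj_eq_iff_im.2 hμ
  · refine le_trans (le_of_eq ?_) hT
    simp [extendToUnitization, selfAdjointInr]
  · simp [unitalExtension]
  · simp
  · simp

/-- The two truncations cost `2δ`. Cutting down `T - μ(T) 1` leaves the scalar contribution `-μ(T)
P_F`, harmless because `μ` is supported by `P_G` and so `|μ(T)|` is bounded uniformly in `T`. -/
theorem mongeKantorovich_le_of_compression (hα : 0 < α) (hω : ∀ n, α ≤ ω n)
    {φ ψ μ : StrongDual ℂ (compactOperators H)} {F G : Finset ℕ} {δ : ℝ}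
    (hμ : μ ∈ stateSpace (compactOperators H)) (hμG : μ (finiteProjection ζ G) = 1)
    (hφ : ∀ u ∈ lipschitzBall (extendToUnitization (weightedSeminorm ζ ω)) μ,
      ‖unitalExtension φ (u : Unitization ℂ (compactOperators H)) -
        ((u : Unitization ℂ (compactOperators H)).fst * φ (finiteProjection ζ F) +
          φ (finiteProjection ζ F * (u : Unitization ℂ (compactOperators H)).snd *
            finiteProjection ζ F))‖ ≤ δ)
    (hψ : ∀ u ∈ lipschitzBall (extendToUnitization (weightedSeminorm ζ ω)) μ,
      ‖unitalExtension ψ (u : Unitization ℂ (compactOperators H)) -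
        ((u : Unitization ℂ (compactOperators H)).fst * ψ (finiteProjection ζ F) +
          ψ (finiteProjection ζ F * (u : Unitization ℂ (compactOperators H)).snd *
            finiteProjection ζ F))‖ ≤ δ) :
    mongeKantorovich (extendToUnitization (weightedSeminorm ζ ω)) φ ψ ≤
      ENNReal.ofReal (2 * δ + ((∑ i ∈ G, ∑ j ∈ G, ω (max i j)) *
          ‖φ (finiteProjection ζ F) - ψ (finiteProjection ζ F)‖ +
        ∑ i ∈ F, ∑ j ∈ F, ω (max i j) * ‖φ (matrixUnit ζ i j) - ψ (matrixUnit ζ i j)‖)) := by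
  rw [mongeKantorovich]
  refine iSup₂_le fun T hT => ?_
  obtain ⟨u, hu, hu1, hu2⟩ := exists_mem_lipschitzBall T
    (im_map_eq_zero hμ (isStarProjection_finiteProjection ζ G) hμG T.2) hT
  have h1 := hφ u hu
  have h2 := hψ u hu
  rw [unitalExtension, hu1, hu2] at h1 h2
  have h3 := dist_map_compression_le hα hω φ ψ F (T := (T : compactOperators H)) hT
  have h4 : ‖μ (T : compactOperators H)‖ ≤ ∑ i ∈ G, ∑ j ∈ G, ω (max i j) :=
    norm_map_le_of_supported hα hω hμ.2.le hμG hT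
  rw [← ofReal_norm]
  refine ENNReal.ofReal_le_ofReal ?_
  have h5 : ‖-μ (T : compactOperators H) *
      (φ (finiteProjection ζ F) - ψ (finiteProjection ζ F))‖ ≤
      (∑ i ∈ G, ∑ j ∈ G, ω (max i j)) *
        ‖φ (finiteProjection ζ F) - ψ (finiteProjection ζ F)‖ := by
    rw [norm_mul, norm_neg]
    exact mul_le_mul_of_nonneg_right h4 (norm_nonneg _)
  generalize φ (finiteProjection ζ F * T * finiteProjection ζ F) = b at h1 h3
  generalize ψ (finiteProjection ζ F * T * finiteProjection ζ F) = c at h2 h3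
  generalize φ (finiteProjection ζ F) = p at h1 h5 ⊢
  generalize ψ (finiteProjection ζ F) = q at h2 h5 ⊢
  generalize μ (T : compactOperators H) = m at h1 h2 h5
  generalize φ (T : compactOperators H) = x at h1 ⊢
  generalize ψ (T : compactOperators H) = y at h2 ⊢
  -- Truncation error of `φ`, minus that of `ψ`, plus the difference of the truncated values.
  have e : x - y = ((-m + x - (-m * p + b)) - (-m + y - (-m * q + c))) +
      (-m * (p - q) + (b - c)) := by ring
  rw [e]
  have h6 := norm_add_le ((-m + x - (-m * p + b)) - (-m + y - (-m * q + c)))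
    (-m * (p - q) + (b - c))
  have h7 := norm_sub_le (-m + x - (-m * p + b)) (-m + y - (-m * q + c))
  have h8 := norm_add_le (-m * (p - q)) (b - c)
  linarith

theorem metrizesWeakStarOn_weightedSeminorm (hα : 0 < α) (hω : ∀ n, α ≤ ω n)
    {S : Set (StrongDual ℂ (compactOperators H))}
    (hS : IsTame (extendToUnitization (weightedSeminorm ζ ω)) (diagonalCompacts ζ) S) :
    MetrizesWeakStarOn (extendToUnitization (weightedSeminorm ζ ω)) S := by
  apply le_antisymm
  · refine continuous_iff_le_induced.1 (@continuous_toWeakDual_of_edist_eq _ _ _ S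
      (PseudoEMetricSpace.induced _ (mongeKantorovichSpace _)) Subtype.val (fun _ _ => rfl) ?_)
    intro a
    -- The summand `1` keeps the constant positive when `a = 0`.
    have hC : 0 < α⁻¹ * ‖(a : compactOperators H)‖ + 1 := by positivity
    refine ⟨_, hC, ?_⟩
    have h1 : extendToUnitization (weightedSeminorm ζ ω)
        (selfAdjointInr ((α⁻¹ * ‖(a : compactOperators H)‖ + 1)⁻¹ • a)) =
        weightedSeminorm ζ ω ((((α⁻¹ * ‖(a : compactOperators H)‖ + 1)⁻¹ : ℝ) : ℂ) •
          (a : compactOperators H)) := by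
      rw [Complex.coe_smul]
      rfl
    rw [h1, weightedSeminorm_smul, abs_of_pos (inv_pos.2 hC)]
    refine (mul_le_mul_right (weightedSeminorm_le hα hω _) _).trans ?_
    rw [← ENNReal.ofReal_mul (inv_pos.2 hC).le]
    refine ENNReal.ofReal_le_one.2 ((inv_mul_le_iff₀ hC).2 ?_)
    linarith
  obtain ⟨μ, hμ, G, hμG, hlim⟩ := (isDiagonalSystem_diagonalCompacts ζ).exists_of_isTame
    (isStarProjection_finiteProjection ζ) hS
  refine @topology_le_of_eventually_edist_lt S _
    (PseudoEMetricSpace.induced _ (mongeKantorovichSpace _)) fun φ ε hε => ?_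
  obtain ⟨r, hr, hrε⟩ : ∃ r : ℝ, 0 < r ∧ ENNReal.ofReal r < ε := by
    obtain ⟨r, hr, hrε⟩ := ENNReal.lt_iff_exists_nnreal_btwn.1 hε
    exact ⟨r, by exact_mod_cast hr, by simpa using hrε⟩
  -- Two truncation errors of `r / 3` and a remainder `R ψ < r / 3` add up to at most `r`.
  obtain ⟨F, hF⟩ := hlim (r / 3) (by positivity)
  -- `R` is the weak* continuous part of the bound, vanishing at `φ`.
  obtain ⟨R, hR⟩ : ∃ R : StrongDual ℂ (compactOperators H) → ℝ, R = fun ψ =>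
      (∑ i ∈ G, ∑ j ∈ G, ω (max i j)) *
        ‖ψ (finiteProjection ζ F) - (φ : StrongDual ℂ _) (finiteProjection ζ F)‖ +
      ∑ i ∈ F, ∑ j ∈ F, ω (max i j) *
        ‖ψ (matrixUnit ζ i j) - (φ : StrongDual ℂ _) (matrixUnit ζ i j)‖ := ⟨_, rfl⟩
  have hdist : ∀ ψ ∈ S, mongeKantorovich (extendToUnitization (weightedSeminorm ζ ω)) ψ φ ≤
      ENNReal.ofReal (2 * (r / 3) + R ψ) := by
    intro ψ hψ
    rw [hR]
    exact mongeKantorovich_le_of_compression hα hω hμ hμG (hF ψ hψ) (hF φ φ.2)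
  have hcont : Continuous fun ψ : WeakDual ℂ (compactOperators H) =>
      R (WeakDual.toStrongDual ψ) := by
    rw [hR]
    have hev : ∀ T : compactOperators H, Continuous fun ψ : WeakDual ℂ (compactOperators H) =>
      WeakDual.toStrongDual ψ T := WeakDual.eval_continuous
    refine (continuous_const.mul ((hev _).sub continuous_const).norm).add ?_
    exact continuous_finsetSum _ fun i _ => continuous_finsetSum _ fun j _ =>
      continuous_const.mul ((hev _).sub continuous_const).norm
  have hR0 : R φ = 0 := by
    simp [hR]
  have hsmall : ∀ᶠ ψ in 𝓝 (StrongDual.toWeakDual (φ : StrongDual ℂ (compactOperators H))),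
      R (WeakDual.toStrongDual ψ) < r / 3 := by
    refine hcont.continuousAt.eventually_lt_const ?_
    change R φ < r / 3
    rw [hR0]
    positivity
  rw [nhds_induced]
  filter_upwards [preimage_mem_comap hsmall] with ψ hψ
  refine (hdist ψ ψ.2).trans_lt (lt_of_le_of_lt (ENNReal.ofReal_le_ofReal ?_) hrε)
  have hψ' : R ψ < r / 3 := hψ
  linarith

end WeightedSeminorm

end QuantumMetric

end

theorem mainTheorem12 {H : Type*} [NormedAddCommGroup H] [InnerProductSpace ℂ H] [CompleteSpace H]
    (ζ : HilbertBasis ℕ ℂ H) (ω : ℕ → ℝ) (α : ℝ) (hα : 0 < α) (hω : ∀ n, α ≤ ω n) :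
    QuantumMetric.diagonalCompacts ζ =
        (NonUnitalStarAlgebra.adjoin ℂ {T : QuantumMetric.compactOperators H |
          ∃ n, (T : H →L[ℂ] H) = QuantumMetric.basisProjection ζ n}).topologicalClosure ∧
      QuantumMetric.IsQuantumLocallyCompactMetricSpace
        (QuantumMetric.extendToUnitization (QuantumMetric.weightedSeminorm ζ ω))
        (QuantumMetric.diagonalCompacts ζ) :=
  ⟨QuantumMetric.diagonalCompacts_eq_topologicalClosure_adjoin ζ,
    { isLipschitzPair := QuantumMetric.isLipschitzPair_weightedSeminorm hα hω
      isTopography := QuantumMetric.isTopography_diagonalCompacts ζ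
      regular := QuantumMetric.isRegular_weightedSeminorm hα hω
      metrizes := fun _ hS => QuantumMetric.metrizesWeakStarOn_weightedSeminorm hα hω hS }⟩
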